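/- Let $q$ be a complex number with $|q|<1$. For $a,p\in\mathbb C$ with $|p|<1$ and $n\in\mathbb Z_{\ge 0}$ put $(a;p)_n=\prod_{j=0}^{n-1}(1-ap^j)$ and $(a;p)_\infty=\prod_{j=0}^{\infty}(1-ap^j)$, and let $[n]=(1-q^n)/(1-q)$. Then the series below converges (absolutely) and $$\sum_{n=0}^{\infty}\frac{q^{2n^2}(q;q^2)_n^2\,(q;q^2)_{2n}}{(q^2;q^2)_{2n}\,(q^6;q^6)_n^2}\,[8n+1]=\frac{(q^3;q^2)_\infty\,(q^3;q^6)_\infty}{(q^2;q^2)_\infty\,(q^6;q^6)_\infty}.$$ -/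

import Mathlib

/-- The finite `q`-Pochhammer symbol `(a;q)_n = ∏_{j=0}^{n-1} (1 - a q^j)`. -/
noncomputable def qPoch (a q : ℂ) (n : ℕ) : ℂ :=
  ∏ j ∈ Finset.range n, (1 - a * q ^ j)

/-- The infinite `q`-Pochhammer symbol `(a;q)_∞ = ∏_{j=0}^∞ (1 - a q^j)`. -/
noncomputable def qPochInf (a q : ℂ) : ℂ :=
  ∏' j : ℕ, (1 - a * q ^ j)

/-- The `q`-number `[n]_q = (1 - q^n) / (1 - q)`. -/
noncomputable def qNum (q : ℂ) (n : ℕ) : ℂ :=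
  (1 - q ^ n) / (1 - q)

/-- For `|q| < 1` the infinite product defining `(a;q)_∞` converges (so that `∏'` above is the
value of the product and not a default value). -/
theorem multipliable_qPochInf (a : ℂ) {q : ℂ} (hq : ‖q‖ < 1) :
    Multipliable (fun j : ℕ => 1 - a * q ^ j) := by
  have h : Summable (fun j : ℕ => ‖-(a * q ^ j)‖) := by
    simp only [norm_neg, norm_mul, norm_pow]
    exact (summable_geometric_of_lt_one (norm_nonneg q) hq).mul_left _
  simpa only [sub_eq_add_neg] using multipliable_one_add_of_summable h

/-!
The series is the case `c = 1`, up to the factor `1 - q`, of the family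
`V(c) = ∑ (1 - c q^{8n+1}) (q;q²)_n² (cq;q²)_{2n} q^{2n²} / ((cq⁶;q⁶)_n² (q²;q²)_{2n})`,
called `cubicSum` below. A Wilf–Zeilberger pair (`cubicTerm_sub_cubicRatio_mul`) gives the
first-order functional equation
`V(c) = (1 - cq) (1 - cq⁵) / (1 - cq⁶)² · V(cq⁶)`.

Iterating it, with dominated convergence as `c q^{6m} → 0`, yields
`V(c) = (cq;q⁶)_∞ (cq⁵;q⁶)_∞ / (cq⁶;q⁶)_∞² · V(0)` (`cubicSum_eq_qPochInf_mul`), so only the constant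
`V(0)` is missing. It comes from the value `c = q⁻³`: there `(cq;q²)_{2n} = (q⁻²;q²)_{2n}` vanishes for
`n ≥ 1`, so `V(q⁻³) = 1 - q⁻²`, which forces
`V(0) = (q³;q⁶)_∞² / ((q²;q⁶)_∞ (q⁴;q⁶)_∞)` (`cubicSum_zero_mul`). Evaluating at `c = 1` and
collecting residues modulo `3` in the infinite products gives the claim. All estimates are made on the
disc `|c q³| ≤ 1`, which contains both `1` and `q⁻³`, is stable under `c ↦ c q⁶`, and keeps `c q⁶`
inside the open unit disc, so that no denominator vanishes.
-/

open Filter Topology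

/-! ### Finite and infinite q-Pochhammer symbols -/

theorem qPoch_zero (a p : ℂ) : qPoch a p 0 = 1 := by
  simp [qPoch]

theorem qPoch_succ (a p : ℂ) (n : ℕ) : qPoch a p (n + 1) = qPoch a p n * (1 - a * p ^ n) := by
  simp [qPoch, Finset.prod_range_succ]

theorem qPoch_succ_left (a p : ℂ) (n : ℕ) :
    qPoch a p (n + 1) = (1 - a) * qPoch (a * p) p n := by
  simp only [qPoch, Finset.prod_range_succ']
  rw [mul_comm]
  congr 1
  · simp
  · exact Finset.prod_congr rfl fun j _ => by ring

theorem norm_mul_pow_le {a p : ℂ} {r : ℝ} (ha : ‖a‖ ≤ r) (hp : ‖p‖ < 1) (j : ℕ) :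
    ‖a * p ^ j‖ ≤ r := by
  rw [norm_mul, norm_pow]
  exact (mul_le_of_le_one_right (norm_nonneg _) (pow_le_one₀ (norm_nonneg _) hp.le)).trans ha

theorem one_sub_ne_zero_of_norm_lt {z : ℂ} (hz : ‖z‖ < 1) : 1 - z ≠ 0 := by
  intro h
  rw [← sub_eq_zero.mp h, norm_one] at hz
  exact lt_irrefl _ hz

theorem qPoch_ne_zero {a p : ℂ} (ha : ‖a‖ < 1) (hp : ‖p‖ < 1) (n : ℕ) : qPoch a p n ≠ 0 :=
  Finset.prod_ne_zero_iff.mpr fun j _ =>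
    one_sub_ne_zero_of_norm_lt ((norm_mul_pow_le le_rfl hp j).trans_lt ha)

theorem qPochInf_ne_zero {a p : ℂ} (ha : ‖a‖ < 1) (hp : ‖p‖ < 1) : qPochInf a p ≠ 0 := by
  have h : Summable (fun j : ℕ => ‖-(a * p ^ j)‖) := by
    simp only [norm_neg, norm_mul, norm_pow]
    exact (summable_geometric_of_lt_one (norm_nonneg p) hp).mul_left _
  have := tprod_one_add_ne_zero_of_summable (f := fun j : ℕ => -(a * p ^ j)) (fun j => by
    rw [← sub_eq_add_neg]
    exact one_sub_ne_zero_of_norm_lt ((norm_mul_pow_le le_rfl hp j).trans_lt ha)) h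
  simpa only [qPochInf, sub_eq_add_neg] using this

theorem tendsto_qPoch (a : ℂ) {p : ℂ} (hp : ‖p‖ < 1) :
    Tendsto (qPoch a p) atTop (𝓝 (qPochInf a p)) :=
  (multipliable_qPochInf a hp).tendsto_prod_tprod_nat

theorem qPochInf_eq_mul (a : ℂ) {p : ℂ} (hp : ‖p‖ < 1) :
    qPochInf a p = (1 - a) * qPochInf (a * p) p := by
  refine tendsto_nhds_unique ((tendsto_qPoch a hp).comp (tendsto_add_atTop_nat 1)) ?_
  refine ((tendsto_qPoch (a * p) hp).const_mul (1 - a)).congr fun n => ?_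
  exact (qPoch_succ_left a p n).symm

theorem qPoch_three_mul (a p : ℂ) (n : ℕ) :
    qPoch a p (3 * n) =
      qPoch a (p ^ 3) n * qPoch (a * p) (p ^ 3) n * qPoch (a * p ^ 2) (p ^ 3) n := by
  induction n with
  | zero => simp [qPoch_zero]
  | succ n ih =>
    rw [show 3 * (n + 1) = 3 * n + 1 + 1 + 1 by ring]
    simp only [qPoch_succ, ih]
    ring

/-- Splitting an infinite product according to the residue of the index modulo `3`. -/
theorem qPochInf_trisect (a : ℂ) {p : ℂ} (hp : ‖p‖ < 1) :
    qPochInf a p =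
      qPochInf a (p ^ 3) * qPochInf (a * p) (p ^ 3) * qPochInf (a * p ^ 2) (p ^ 3) := by
  have hp3 : ‖p ^ 3‖ < 1 := by
    rw [norm_pow]
    exact pow_lt_one₀ (norm_nonneg _) hp (by norm_num)
  refine tendsto_nhds_unique
    ((tendsto_qPoch a hp).comp (tendsto_id.const_mul_atTop' (by norm_num : 0 < 3))) ?_
  refine (((tendsto_qPoch a hp3).mul (tendsto_qPoch (a * p) hp3)).mul
    (tendsto_qPoch (a * p ^ 2) hp3)).congr fun n => ?_
  exact (qPoch_three_mul a p n).symm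

theorem norm_qPoch_le {a p : ℂ} {M : ℝ} (ha : ‖a‖ ≤ M) (hp : ‖p‖ < 1) (n : ℕ) :
    ‖qPoch a p n‖ ≤ Real.exp (M * (1 - ‖p‖)⁻¹) := by
  have hM : 0 ≤ M := (norm_nonneg a).trans ha
  calc ‖qPoch a p n‖ = ∏ j ∈ Finset.range n, ‖1 - a * p ^ j‖ := by rw [qPoch, norm_prod]
    _ ≤ ∏ j ∈ Finset.range n, (1 + M * ‖p‖ ^ j) := by
        refine Finset.prod_le_prod (fun _ _ => norm_nonneg _) fun j _ => ?_
        refine (norm_sub_le _ _).trans ?_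
        rw [norm_one, norm_mul, norm_pow]
        gcongr
    _ ≤ Real.exp (∑ j ∈ Finset.range n, M * ‖p‖ ^ j) :=
        Real.prod_one_add_le_exp_sum _ fun j => by positivity
    _ ≤ _ := by
        rw [← Finset.mul_sum, ← tsum_geometric_of_lt_one (norm_nonneg p) hp]
        gcongr
        exact (summable_geometric_of_lt_one (norm_nonneg p) hp).sum_le_tsum _
          fun _ _ => by positivity

/-- The reciprocals of `(a;p)_n` are bounded uniformly in `n` and in `a` with `|a| ≤ r < 1`,
since `1 / |1 - z| ≤ 1 + |z| / (1 - r)` for `|z| ≤ r`. -/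
theorem norm_inv_qPoch_le {a p : ℂ} {r : ℝ} (ha : ‖a‖ ≤ r) (hr : r < 1) (hp : ‖p‖ < 1) (n : ℕ) :
    ‖(qPoch a p n)⁻¹‖ ≤ Real.exp ((1 - r)⁻¹ * (1 - ‖p‖)⁻¹) := by
  have hr' : 0 < 1 - r := sub_pos.mpr hr
  calc ‖(qPoch a p n)⁻¹‖ = ∏ j ∈ Finset.range n, ‖1 - a * p ^ j‖⁻¹ := by
        rw [qPoch, norm_inv, norm_prod, Finset.prod_inv_distrib]
    _ ≤ ∏ j ∈ Finset.range n, (1 + (1 - r)⁻¹ * ‖p‖ ^ j) := by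
        refine Finset.prod_le_prod (fun _ _ => by positivity) fun j _ => ?_
        have h1 : ‖a * p ^ j‖ ≤ r := norm_mul_pow_le ha hp j
        have h2 : ‖a * p ^ j‖ ≤ ‖p‖ ^ j := by
          rw [norm_mul, norm_pow]
          exact mul_le_of_le_one_left (by positivity) (ha.trans hr.le)
        have h3 : 1 - ‖a * p ^ j‖ ≤ ‖1 - a * p ^ j‖ := by
          simpa using norm_sub_norm_le (1 : ℂ) (a * p ^ j)
        have h4 : 0 < 1 - ‖a * p ^ j‖ := by linarith
        calc ‖1 - a * p ^ j‖⁻¹ ≤ (1 - ‖a * p ^ j‖)⁻¹ := inv_anti₀ h4 h3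
          _ = 1 + (1 - ‖a * p ^ j‖)⁻¹ * ‖a * p ^ j‖ := by field_simp; ring
          _ ≤ 1 + (1 - r)⁻¹ * ‖p‖ ^ j := by gcongr
    _ ≤ Real.exp (∑ j ∈ Finset.range n, (1 - r)⁻¹ * ‖p‖ ^ j) :=
        Real.prod_one_add_le_exp_sum _ fun j => by positivity
    _ ≤ _ := by
        rw [← Finset.mul_sum, ← tsum_geometric_of_lt_one (norm_nonneg p) hp]
        gcongr
        exact (summable_geometric_of_lt_one (norm_nonneg p) hp).sum_le_tsum _
          fun _ _ => by positivity

/-! ### The Wilf–Zeilberger pair -/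

/-- The summand of the one-parameter family
`∑ (1 - c q^{8n+1}) (q;q²)_n² (cq;q²)_{2n} q^{2n²} / ((cq⁶;q⁶)_n² (q²;q²)_{2n})`; at `c = 1` it is
`1 - q` times the summand of the series to be evaluated. -/
noncomputable def cubicTerm (q c : ℂ) (n : ℕ) : ℂ :=
  (1 - c * q ^ (8 * n + 1)) * qPoch q (q ^ 2) n ^ 2 * qPoch (c * q) (q ^ 2) (2 * n)
    * (qPoch (c * q ^ 6) (q ^ 6) n)⁻¹ ^ 2 * (qPoch (q ^ 2) (q ^ 2) (2 * n))⁻¹ * q ^ (2 * n ^ 2)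

/-- The Wilf–Zeilberger certificate for the shift `c ↦ c q⁶` in `cubicTerm`. For `n ≥ 1` it is
`c q³ (1 - q^{4n}) (1 - q^{4n-2}) / ((1 - c q³) (1 - c q^{8n+1}))` times `cubicTerm q c n`, with the
factor `1 - c q³` cancelled so that the certificate makes sense at `c = q⁻³`. -/
noncomputable def cubicCert (q c : ℂ) : ℕ → ℂ
  | 0 => 0
  | n + 1 => c * q ^ 3 * (1 - c * q) * qPoch (c * q ^ 5) (q ^ 2) (2 * n)
      * qPoch q (q ^ 2) (n + 1) ^ 2 * (qPoch (c * q ^ 6) (q ^ 6) (n + 1))⁻¹ ^ 2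
      * (qPoch (q ^ 2) (q ^ 2) (2 * n))⁻¹ * q ^ (2 * (n + 1) ^ 2)

/-- The multiplier in the functional equation of the sum of `cubicTerm` under `c ↦ c q⁶`. -/
noncomputable def cubicRatio (q c : ℂ) : ℂ :=
  (1 - c * q) * (1 - c * q ^ 5) / (1 - c * q ^ 6) ^ 2

theorem norm_pow_lt_one {q : ℂ} (hq : ‖q‖ < 1) {k : ℕ} (hk : k ≠ 0) : ‖q ^ k‖ < 1 := by
  rw [norm_pow]
  exact pow_lt_one₀ (norm_nonneg _) hq hk

theorem norm_mul_pow_six_le {q c : ℂ} (hc : ‖c * q ^ 3‖ ≤ 1) : ‖c * q ^ 6‖ ≤ ‖q‖ ^ 3 := by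
  rw [show c * q ^ 6 = c * q ^ 3 * q ^ 3 by ring, norm_mul, norm_pow q]
  exact mul_le_of_le_one_left (by positivity) hc

theorem norm_mul_pow_six_lt {q c : ℂ} (hq : ‖q‖ < 1) (hc : ‖c * q ^ 3‖ ≤ 1) :
    ‖c * q ^ 6‖ < 1 :=
  (norm_mul_pow_six_le hc).trans_lt (pow_lt_one₀ (norm_nonneg _) hq (by norm_num))

/-- The Wilf–Zeilberger equation for `cubicTerm`. -/
theorem cubicTerm_sub_cubicRatio_mul {q c : ℂ} (hq : ‖q‖ < 1) (hc : ‖c * q ^ 3‖ ≤ 1) (n : ℕ) :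
    cubicTerm q c n - cubicRatio q c * cubicTerm q (c * q ^ 6) n =
      cubicCert q c (n + 1) - cubicCert q c n := by
  have hc6 : ‖c * q ^ 6‖ < 1 := norm_mul_pow_six_lt hq hc
  have h1 : 1 - c * q ^ 6 ≠ 0 := one_sub_ne_zero_of_norm_lt hc6
  have hq6 : ‖q ^ 6‖ < 1 := norm_pow_lt_one hq (by norm_num)
  have hq2 : ‖q ^ 2‖ < 1 := norm_pow_lt_one hq (by norm_num)
  rcases n with _ | m
  · simp only [cubicTerm, cubicCert, cubicRatio, qPoch_succ, qPoch_zero, mul_zero]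
    field_simp
    ring
  · have hA : ∀ k, qPoch (c * q ^ 6) (q ^ 6) k ≠ 0 := qPoch_ne_zero hc6 hq6
    have hB : ∀ k, qPoch (q ^ 2) (q ^ 2) k ≠ 0 := qPoch_ne_zero hq2 hq2
    have hA2 := hA (m + 1 + 1)
    have hA1 := hA (m + 1)
    have hB2 := hB (2 * m + 1 + 1)
    have hB0 := hB (2 * m)
    have hD : qPoch (c * q ^ 6 * q ^ 6) (q ^ 6) (m + 1)
        = qPoch (c * q ^ 6) (q ^ 6) (m + 1) * (1 - c * q ^ 6 * (q ^ 6) ^ (m + 1))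
          / (1 - c * q ^ 6) := by
      rw [eq_div_iff h1, ← qPoch_succ, qPoch_succ_left (c * q ^ 6)]
      ring
    have hN : qPoch (c * q) (q ^ 2) (2 * m + 1 + 1)
        = (1 - c * q) * (1 - c * q ^ 3) * qPoch (c * q ^ 5) (q ^ 2) (2 * m) := by
      rw [qPoch_succ_left, qPoch_succ_left]
      ring_nf
    have hM : (1 - c * q ^ 5) * qPoch (c * q ^ 6 * q) (q ^ 2) (2 * m + 1 + 1)
        = qPoch (c * q ^ 5) (q ^ 2) (2 * m) * (1 - c * q ^ 5 * (q ^ 2) ^ (2 * m))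
          * (1 - c * q ^ 5 * (q ^ 2) ^ (2 * m + 1)) * (1 - c * q ^ 5 * (q ^ 2) ^ (2 * m + 2)) := by
      rw [← qPoch_succ, ← qPoch_succ, ← qPoch_succ, qPoch_succ_left (c * q ^ 5)]
      ring_nf
    have hE : q ^ (2 * (m + 1 + 1) ^ 2) = q ^ (2 * (m + 1) ^ 2) * (q ^ m) ^ 4 * q ^ 6 := by ring
    -- The factor `1 - c q⁵` of the multiplier is absorbed before division, so it may vanish.
    have hR : cubicRatio q c * cubicTerm q (c * q ^ 6) (m + 1) =
        (1 - c * q) / (1 - c * q ^ 6) ^ 2 * (1 - c * q ^ 6 * q ^ (8 * (m + 1) + 1))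
          * qPoch q (q ^ 2) (m + 1) ^ 2
          * ((1 - c * q ^ 5) * qPoch (c * q ^ 6 * q) (q ^ 2) (2 * m + 1 + 1))
          * (qPoch (c * q ^ 6 * q ^ 6) (q ^ 6) (m + 1))⁻¹ ^ 2
          * (qPoch (q ^ 2) (q ^ 2) (2 * m + 1 + 1))⁻¹ * q ^ (2 * (m + 1) ^ 2) := by
      rw [cubicRatio, cubicTerm, show 2 * (m + 1) = 2 * m + 1 + 1 by ring]
      ring
    rw [hR, hM, hD, cubicTerm, cubicCert, cubicCert, show 2 * (m + 1) = 2 * m + 1 + 1 by ring, hN,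
      hE]
    rw [qPoch_succ q (q ^ 2) (m + 1)]
    rw [qPoch_succ _ _ (m + 1)] at hA2 ⊢
    rw [qPoch_succ _ _ (2 * m + 1), qPoch_succ _ _ (2 * m)] at hB2 ⊢
    rw [qPoch_succ (c * q ^ 5) _ (2 * m + 1), qPoch_succ (c * q ^ 5) _ (2 * m)]
    have hA3 := right_ne_zero_of_mul hA2
    have hB3 := right_ne_zero_of_mul hB2
    have hB4 := right_ne_zero_of_mul (left_ne_zero_of_mul hB2)
    -- What is left is a rational identity in `c`, `q` and `x = q ^ m`.
    clear hA hB hD hN hM hE hR hA2 hB2 hc6 hq6 hq2 hq hc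
    generalize qPoch (c * q ^ 6) (q ^ 6) (m + 1) = A at *
    generalize qPoch (q ^ 2) (q ^ 2) (2 * m) = B at *
    generalize qPoch (c * q ^ 5) (q ^ 2) (2 * m) = P at *
    generalize qPoch q (q ^ 2) (m + 1) = Q at *
    generalize q ^ (2 * (m + 1) ^ 2) = E at *
    have e1 : c * q ^ 6 * (q ^ 6) ^ (m + 1) = c * q ^ 12 * (q ^ m) ^ 6 := by ring
    have e2 : q ^ 2 * (q ^ 2) ^ (2 * m + 1) = q ^ 4 * (q ^ m) ^ 4 := by ring
    have e3 : q ^ 2 * (q ^ 2) ^ (2 * m) = q ^ 2 * (q ^ m) ^ 4 := by ring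
    have e4 : q ^ (8 * (m + 1) + 1) = q ^ 9 * (q ^ m) ^ 8 := by ring
    have e5 : (q ^ 2) ^ (2 * m) = (q ^ m) ^ 4 := by ring
    have e6 : (q ^ 2) ^ (2 * m + 1) = q ^ 2 * (q ^ m) ^ 4 := by ring
    have e7 : (q ^ 2) ^ (2 * m + 2) = q ^ 4 * (q ^ m) ^ 4 := by ring
    have e8 : (q ^ 2) ^ (m + 1) = q ^ 2 * (q ^ m) ^ 2 := by ring
    rw [e1] at hA3 ⊢
    rw [e2] at hB3 ⊢
    rw [e3] at hB4 ⊢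
    rw [e4, e5, e6, e7, e8]
    generalize q ^ m = x at *
    clear e1 e2 e3 e4 e5 e6 e7 e8
    generalize hu : 1 - c * q ^ 12 * x ^ 6 = u at *
    generalize hv : 1 - q ^ 4 * x ^ 4 = v at *
    generalize hw : 1 - q ^ 2 * x ^ 4 = w at *
    generalize hz : 1 - c * q ^ 6 = z at *
    field_simp
    subst hu hv hw hz
    ring

/-! ### The functional equation and its iteration -/

/-- Up to the Gaussian factor `q^{2n²}`, `cubicTerm` is a product of finite `q`-Pochhammer symbols
and their inverses, all bounded uniformly in `n` and `c`. -/
theorem exists_norm_cubicTerm_le {q : ℂ} (hq : ‖q‖ < 1) (K : ℝ) :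
    ∃ C : ℝ, ∀ c : ℂ, ‖c‖ ≤ K → ‖c * q ^ 3‖ ≤ 1 → ∀ n, ‖cubicTerm q c n‖ ≤ C * ‖q‖ ^ n := by
  have hq6 : ‖q ^ 6‖ < 1 := norm_pow_lt_one hq (by norm_num)
  have hq2 : ‖q ^ 2‖ < 1 := norm_pow_lt_one hq (by norm_num)
  have hq3 : ‖q‖ ^ 3 < 1 := pow_lt_one₀ (norm_nonneg _) hq (by norm_num)
  refine ⟨(1 + K) * Real.exp (1 * (1 - ‖q ^ 2‖)⁻¹) ^ 2 * Real.exp (K * (1 - ‖q ^ 2‖)⁻¹)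
    * Real.exp ((1 - ‖q‖ ^ 3)⁻¹ * (1 - ‖q ^ 6‖)⁻¹) ^ 2
    * Real.exp ((1 - ‖q ^ 2‖)⁻¹ * (1 - ‖q ^ 2‖)⁻¹), fun c hcK hc n => ?_⟩
  have hK : 0 ≤ K := (norm_nonneg c).trans hcK
  have h1 : ‖1 - c * q ^ (8 * n + 1)‖ ≤ 1 + K := by
    refine (norm_sub_le _ _).trans ?_
    rw [norm_one]
    gcongr
    exact norm_mul_pow_le hcK hq _
  have h2 := norm_qPoch_le hq.le hq2 n
  have h3 := norm_qPoch_le (a := c * q) (by simpa using norm_mul_pow_le hcK hq 1) hq2 (2 * n)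
  have h4 := norm_inv_qPoch_le (norm_mul_pow_six_le hc) hq3 hq6 n
  have h5 := norm_inv_qPoch_le (a := q ^ 2) le_rfl hq2 hq2 (2 * n)
  have h6 : ‖q ^ (2 * n ^ 2)‖ ≤ ‖q‖ ^ n := by
    rw [norm_pow]
    exact pow_le_pow_of_le_one (norm_nonneg _) hq.le (by nlinarith)
  rw [cubicTerm, norm_mul, norm_mul, norm_mul, norm_mul, norm_mul, norm_pow (qPoch q _ _),
    norm_pow (qPoch _ _ _)⁻¹]
  gcongr

theorem tendsto_cubicCert {q c : ℂ} (hq : ‖q‖ < 1) (hc : ‖c * q ^ 3‖ ≤ 1) :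
    Tendsto (cubicCert q c) atTop (𝓝 0) := by
  have hc6 : ‖c * q ^ 6‖ < 1 := norm_mul_pow_six_lt hq hc
  have hq6 : ‖q ^ 6‖ < 1 := norm_pow_lt_one hq (by norm_num)
  have hq2 : ‖q ^ 2‖ < 1 := norm_pow_lt_one hq (by norm_num)
  have hsucc := tendsto_add_atTop_nat 1
  have hdbl : Tendsto (fun n : ℕ => 2 * n) atTop atTop :=
    tendsto_id.const_mul_atTop' (by norm_num)
  have hE : Tendsto (fun n : ℕ => q ^ (2 * (n + 1) ^ 2)) atTop (𝓝 0) :=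
    (tendsto_pow_atTop_nhds_zero_of_norm_lt_one hq).comp
      (tendsto_atTop_mono (fun n => show n ≤ _ by nlinarith) tendsto_id)
  rw [← tendsto_add_atTop_iff_nat 1]
  have h := ((((((tendsto_qPoch (c * q ^ 5) hq2).comp hdbl).const_mul
    (c * q ^ 3 * (1 - c * q))).mul (((tendsto_qPoch q hq2).comp hsucc).pow 2)).mul
    ((((tendsto_qPoch (c * q ^ 6) hq6).comp hsucc).inv₀ (qPochInf_ne_zero hc6 hq6)).pow 2)).mul
    (((tendsto_qPoch (q ^ 2) hq2).comp hdbl).inv₀ (qPochInf_ne_zero hq2 hq2))).mul hE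
  rw [mul_zero] at h
  exact h

/-- The sum of `cubicTerm` over all `n`. -/
noncomputable def cubicSum (q c : ℂ) : ℂ :=
  ∑' n, cubicTerm q c n

theorem summable_cubicTerm {q c : ℂ} (hq : ‖q‖ < 1) (hc : ‖c * q ^ 3‖ ≤ 1) :
    Summable (cubicTerm q c) := by
  obtain ⟨C, hC⟩ := exists_norm_cubicTerm_le hq ‖c‖
  exact Summable.of_norm_bounded
    ((summable_geometric_of_lt_one (norm_nonneg q) hq).mul_left C) (hC c le_rfl hc)

theorem norm_mul_pow_three_le_one {q c : ℂ} (hq : ‖q‖ < 1) (hc : ‖c * q ^ 3‖ ≤ 1) (m : ℕ) :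
    ‖c * (q ^ 6) ^ m * q ^ 3‖ ≤ 1 := by
  rw [mul_right_comm]
  exact norm_mul_pow_le hc (norm_pow_lt_one hq (by norm_num)) m

/-- The functional equation of `cubicSum`, obtained by summing the Wilf–Zeilberger equation. -/
theorem cubicSum_eq_cubicRatio_mul {q c : ℂ} (hq : ‖q‖ < 1) (hc : ‖c * q ^ 3‖ ≤ 1) :
    cubicSum q c = cubicRatio q c * cubicSum q (c * q ^ 6) := by
  have hc' : ‖c * q ^ 6 * q ^ 3‖ ≤ 1 := by simpa using norm_mul_pow_three_le_one hq hc 1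
  have h1 := ((summable_cubicTerm hq hc).hasSum.sub
    ((summable_cubicTerm hq hc').hasSum.mul_left (cubicRatio q c))).tendsto_sum_nat
  simp only [cubicTerm_sub_cubicRatio_mul hq hc, Finset.sum_range_sub] at h1
  have h2 : Tendsto (fun n => cubicCert q c n - cubicCert q c 0) atTop (𝓝 0) := by
    rw [show cubicCert q c 0 = 0 from rfl]
    simpa only [sub_zero] using tendsto_cubicCert hq hc
  exact sub_eq_zero.mp (tendsto_nhds_unique h1 h2)

theorem cubicSum_eq_qPoch_mul {q c : ℂ} (hq : ‖q‖ < 1) (hc : ‖c * q ^ 3‖ ≤ 1) (m : ℕ) :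
    cubicSum q c = qPoch (c * q) (q ^ 6) m * qPoch (c * q ^ 5) (q ^ 6) m
      * (qPoch (c * q ^ 6) (q ^ 6) m)⁻¹ ^ 2 * cubicSum q (c * (q ^ 6) ^ m) := by
  induction m with
  | zero => simp [qPoch_zero]
  | succ m ih =>
    rw [ih, cubicSum_eq_cubicRatio_mul hq (norm_mul_pow_three_le_one hq hc m), cubicRatio]
    rw [show c * (q ^ 6) ^ (m + 1) = c * (q ^ 6) ^ m * q ^ 6 by ring]
    simp only [qPoch_succ, mul_inv, mul_pow]
    rw [mul_right_comm c (q ^ 6) ((q ^ 6) ^ m)]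
    generalize 1 - c * (q ^ 6) ^ m * q ^ 6 = u
    ring

theorem continuousAt_cubicTerm_zero (q : ℂ) (n : ℕ) :
    ContinuousAt (fun c => cubicTerm q c n) 0 := by
  have h : ∀ p r : ℂ, ∀ k, Continuous fun c => qPoch (c * r) p k := fun p r k => by
    unfold qPoch
    fun_prop
  have h0 : qPoch (0 * q ^ 6) (q ^ 6) n ≠ 0 := by simp [qPoch]
  unfold cubicTerm
  have h1 := (h (q ^ 6) (q ^ 6) n).continuousAt.inv₀ h0
  have h2 := (h (q ^ 2) q (2 * n)).continuousAt (x := 0)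
  have h3 : ContinuousAt (fun c : ℂ => 1 - c * q ^ (8 * n + 1)) 0 := by fun_prop
  exact ((((h3.mul continuousAt_const).mul h2).mul (h1.pow 2)).mul continuousAt_const).mul
    continuousAt_const

theorem tendsto_cubicSum {q c : ℂ} (hq : ‖q‖ < 1) (hc : ‖c * q ^ 3‖ ≤ 1) :
    Tendsto (fun m : ℕ => cubicSum q (c * (q ^ 6) ^ m)) atTop (𝓝 (cubicSum q 0)) := by
  have hq6 : ‖q ^ 6‖ < 1 := norm_pow_lt_one hq (by norm_num)
  obtain ⟨C, hC⟩ := exists_norm_cubicTerm_le hq ‖c‖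
  refine tendsto_tsum_of_dominated_convergence
    ((summable_geometric_of_lt_one (norm_nonneg q) hq).mul_left C) (fun n => ?_)
    (Eventually.of_forall fun m =>
      hC _ (norm_mul_pow_le le_rfl hq6 m) (norm_mul_pow_three_le_one hq hc m))
  refine (continuousAt_cubicTerm_zero q n).tendsto.comp ?_
  simpa using (tendsto_pow_atTop_nhds_zero_of_norm_lt_one hq6).const_mul c

/-- Iterating the functional equation drives `c q^{6m}` to `0`. -/
theorem cubicSum_eq_qPochInf_mul {q c : ℂ} (hq : ‖q‖ < 1) (hc : ‖c * q ^ 3‖ ≤ 1) :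
    cubicSum q c = qPochInf (c * q) (q ^ 6) * qPochInf (c * q ^ 5) (q ^ 6)
      * (qPochInf (c * q ^ 6) (q ^ 6))⁻¹ ^ 2 * cubicSum q 0 := by
  have hq6 : ‖q ^ 6‖ < 1 := norm_pow_lt_one hq (by norm_num)
  have h := (((tendsto_qPoch (c * q) hq6).mul (tendsto_qPoch (c * q ^ 5) hq6)).mul
    (((tendsto_qPoch (c * q ^ 6) hq6).inv₀
      (qPochInf_ne_zero (norm_mul_pow_six_lt hq hc) hq6)).pow 2)).mul (tendsto_cubicSum hq hc)
  exact tendsto_nhds_unique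
    (tendsto_const_nhds.congr fun m => cubicSum_eq_qPoch_mul hq hc m) h

/-! ### Evaluation at two values of the parameter -/

/-- At `c = q⁻³` the factor `(q⁻²;q²)_{2n}` kills every term with `n ≥ 1`. -/
theorem cubicSum_inv_pow_three {q : ℂ} (hq0 : q ≠ 0) :
    cubicSum q (q ^ 3)⁻¹ = 1 - (q ^ 2)⁻¹ := by
  rw [cubicSum, tsum_eq_single 0]
  · simp only [cubicTerm, mul_zero, qPoch_zero]
    field_simp
    ring
  · intro n hn
    obtain ⟨m, rfl⟩ := Nat.exists_eq_succ_of_ne_zero hn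
    have h : qPoch ((q ^ 3)⁻¹ * q) (q ^ 2) (2 * (m + 1)) = 0 := by
      rw [show 2 * (m + 1) = 2 * m + 1 + 1 by ring, qPoch_succ_left, qPoch_succ_left]
      have : (q ^ 3)⁻¹ * q * q ^ 2 = 1 := by field_simp
      simp [this]
    simp [cubicTerm, h]

/-- The constant `cubicSum q 0` is read off from the terminating case `c = q⁻³`. -/
theorem cubicSum_zero_mul {q : ℂ} (hq0 : q ≠ 0) (hq : ‖q‖ < 1) :
    qPochInf (q ^ 2) (q ^ 6) * qPochInf (q ^ 4) (q ^ 6) * cubicSum q 0 =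
      qPochInf (q ^ 3) (q ^ 6) ^ 2 := by
  have hq6 : ‖q ^ 6‖ < 1 := norm_pow_lt_one hq (by norm_num)
  have h3 := qPochInf_ne_zero (norm_pow_lt_one hq (by norm_num : 3 ≠ 0)) hq6
  have h := cubicSum_eq_qPochInf_mul hq (c := (q ^ 3)⁻¹)
    (by rw [inv_mul_cancel₀ (pow_ne_zero 3 hq0), norm_one])
  rw [cubicSum_inv_pow_three hq0, show (q ^ 3)⁻¹ * q = (q ^ 2)⁻¹ by field_simp,
    show (q ^ 3)⁻¹ * q ^ 5 = q ^ 2 by field_simp, show (q ^ 3)⁻¹ * q ^ 6 = q ^ 3 by field_simp,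
    qPochInf_eq_mul (q ^ 2)⁻¹ hq6, show (q ^ 2)⁻¹ * q ^ 6 = q ^ 4 by field_simp] at h
  have hne : 1 - (q ^ 2)⁻¹ ≠ 0 := by
    intro h0
    refine one_sub_ne_zero_of_norm_lt (norm_pow_lt_one hq two_ne_zero) ?_
    rw [inv_eq_one.mp (sub_eq_zero.mp h0).symm, sub_self]
  refine mul_left_cancel₀ hne ?_
  field_simp at h ⊢
  linear_combination -h

theorem cubicSum_one {q : ℂ} (hq0 : q ≠ 0) (hq : ‖q‖ < 1) :
    cubicSum q 1 = (1 - q) * (qPochInf (q ^ 3) (q ^ 2) * qPochInf (q ^ 3) (q ^ 6)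
      / (qPochInf (q ^ 2) (q ^ 2) * qPochInf (q ^ 6) (q ^ 6))) := by
  have hq2 : ‖q ^ 2‖ < 1 := norm_pow_lt_one hq (by norm_num)
  have hq4 : ‖q ^ 4‖ < 1 := norm_pow_lt_one hq (by norm_num)
  have hq6 : ‖q ^ 6‖ < 1 := norm_pow_lt_one hq (by norm_num)
  have h2 := qPochInf_ne_zero hq2 hq6
  have h4 := qPochInf_ne_zero hq4 hq6
  have h6 := qPochInf_ne_zero hq6 hq6
  have h := cubicSum_eq_qPochInf_mul hq (c := 1)
    (by simpa using pow_le_one₀ (norm_nonneg q) hq.le)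
  have h0 := cubicSum_zero_mul hq0 hq
  have e3 := qPochInf_trisect (q ^ 3) hq2
  have e2 := qPochInf_trisect (q ^ 2) hq2
  have e1 := qPochInf_eq_mul q hq6
  simp only [← pow_mul, ← pow_add, ← pow_succ', one_mul, Nat.reduceMul, Nat.reduceAdd]
    at h e1 e2 e3
  rw [h, e1, e2, e3]
  field_simp
  linear_combination (1 - q) * qPochInf (q ^ 7) (q ^ 6) * qPochInf (q ^ 5) (q ^ 6) * h0

theorem theorem2 (q : ℂ) (hq : ‖q‖ < 1) :
    HasSum
      (fun n : ℕ =>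
        q ^ (2 * n ^ 2) * qPoch q (q ^ 2) n ^ 2 * qPoch q (q ^ 2) (2 * n)
          / (qPoch (q ^ 2) (q ^ 2) (2 * n) * qPoch (q ^ 6) (q ^ 6) n ^ 2)
          * qNum q (8 * n + 1))
      (qPochInf (q ^ 3) (q ^ 2) * qPochInf (q ^ 3) (q ^ 6)
        / (qPochInf (q ^ 2) (q ^ 2) * qPochInf (q ^ 6) (q ^ 6))) := by
  rcases eq_or_ne q 0 with rfl | hq0
  · -- At `q = 0` only the term `n = 0` survives, and every infinite product is empty.
    have h : qPochInf 0 0 = 1 := by simp [qPochInf]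
    simp only [ne_eq, OfNat.ofNat_ne_zero, not_false_eq_true, zero_pow, h, mul_one, div_one]
    convert hasSum_single (0 : ℕ) fun n hn => ?_ using 1
    · simp [qPoch, qNum]
    · simp [hn]
  · have h1 : 1 - q ≠ 0 := one_sub_ne_zero_of_norm_lt hq
    have h := (summable_cubicTerm hq (c := 1)
      (by simpa using pow_le_one₀ (norm_nonneg q) hq.le)).hasSum
    rw [← cubicSum, cubicSum_one hq0 hq] at h
    replace h := h.mul_left (1 - q)⁻¹
    rw [inv_mul_cancel_left₀ h1] at h
    refine h.congr_fun fun n => ?_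
    simp only [cubicTerm, qNum, one_mul]
    ring
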